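/- Let $n\ge 4$, $N=\{1,\dots,n\}$, $N_1=N\setminus\{1\}$ and $A=\{ij : i,j\in N,\ i\ne j\}$. For $S\subseteq N$ let $\delta^+(S)$ be the set of arcs $ij\in A$ with $i\in S$, $j\notin S$, let $\delta^-(S)$ be the set of arcs $ij\in A$ with $i\notin S$, $j\in S$, and let $A(S)$ be the set of arcs with both ends in $S$; write $\delta^\pm(i)=\delta^\pm(\{i\})$. Let $\mathcal S_1=\{S\subseteq N_1 : |S|\ge 2\}$, and let $$P_{\mathrm{AP}}=\Big\{x\in[0,1]^A : \sum_{a\in\delta^+(i)}x_a=1 \text{ and } \sum_{a\in\delta^-(i)}x_a=1\ \text{ for all } i\in N\Big\}.$$ For $b\in\mathbb R^{N_1}_+$ with $\sum_{i\in N_1}b_i=1$ let $Q_{\mathrm{SCF}}(b)$ be the set of pairs $(x,f)\in P_{\mathrm{AP}}\times\mathbb R^A_+$ such that $f_a\le x_a$ for all $a\in A$, $\sum_{a\in\delta^+(1)}f_a-\sum_{a\in\delta^-(1)}f_a=1$, and $\sum_{a\in\delta^+(i)}f_a-\sum_{a\in\delta^-(i)}f_a=-b_i$ for all $i\in N_1$.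 Let $P_{\mathrm{SCF}}(b)=\{x : (x,f)\in Q_{\mathrm{SCF}}(b)\text{ for some } f\}$ be its projection onto the $x$-variables. Let $B=\{b\in\mathbb R^{N_1} : b_i>0\text{ for all } i\in N_1,\ \sum_{i\in N_1}b_i=1\}$, and for $k\in N_1$ let $b^k\in\mathbb R^{N_1}$ be the $k$-th canonical (unit) vector. Then $$\bigcap_{b\in B}P_{\mathrm{SCF}}(b)=\bigcap_{k\in N_1}P_{\mathrm{SCF}}(b^k)=\overline P_{\mathrm{SCF}},\qquad\text{where}\qquad \overline P_{\mathrm{SCF}}=\Big\{x\in P_{\mathrm{AP}} : \sum_{a\in\delta^+(S)}x_a\ge 1\ \text{ for all } S\in\mathcal S_1\Big\}.$$ This is the Dantzig–Fulkerson–Johnson (DFJ) polytope, that is, $$\overline P_{\mathrm{SCF}}=\Big\{x\in P_{\mathrm{AP}} : \sum_{a\in A(S)}x_a\le |S|-1\ \text{ for all } S\in\mathcal S_1\Big\}.$$ Moreover, $\overline P_{\mathrm{SCF}}$ is the projection onto the $x$-variables of the multi-commodity flow (MCF) extended formulation, which is the set of all $(x,(f^k)_{k\in N_1})\in P_{\mathrm{AP}}\times(\mathbb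 R^A_+)^{N_1}$ such that, for all $k\in N_1$, $f^k_a\le x_a$ for all $a\in A$ and $$\sum_{a\in\delta^+(i)}f^k_a-\sum_{a\in\delta^-(i)}f^k_a=\begin{cases}1& i=1\\-1& i=k\\0& i\in N_1,\ i\ne k\end{cases}\qquad\text{for all } i\in N.$$ -/

import Mathlib

namespace ATSP

/-- The arcs `ij`, `i ≠ j`, of the complete directed graph on the `n` nodes `Fin n`.
The special node, called node 1 on paper, is `0 : Fin n`. -/
abbrev Arc (n : ℕ) : Type := {a : Fin n × Fin n // a.1 ≠ a.2}

/-- The nodes other than the special node. -/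
abbrev Node1 (n : ℕ) [NeZero n] : Type := {i : Fin n // i ≠ 0}

/-- `δ⁺(S)`: the arcs leaving `S`. -/
def outArcs {n : ℕ} (S : Finset (Fin n)) : Finset (Arc n) :=
  Finset.univ.filter fun a => a.1.1 ∈ S ∧ a.1.2 ∉ S

/-- `δ⁻(S)`: the arcs entering `S`. -/
def inArcs {n : ℕ} (S : Finset (Fin n)) : Finset (Arc n) :=
  Finset.univ.filter fun a => a.1.1 ∉ S ∧ a.1.2 ∈ S

/-- `A(S)`: the arcs with both ends in `S`. -/
def insideArcs {n : ℕ} (S : Finset (Fin n)) : Finset (Arc n) :=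
  Finset.univ.filter fun a => a.1.1 ∈ S ∧ a.1.2 ∈ S

/-- The family `𝒮₁` of node sets of size at least 2 that avoid the special node. -/
def subtourSets (n : ℕ) [NeZero n] : Set (Finset (Fin n)) :=
  {S | 0 ∉ S ∧ 2 ≤ S.card}

/-- The (restricted) assignment polytope. -/
def PAP (n : ℕ) : Set (Arc n → ℝ) :=
  {x | (∀ a, 0 ≤ x a ∧ x a ≤ 1) ∧
    (∀ i, ∑ a ∈ outArcs {i}, x a = 1) ∧
    (∀ i, ∑ a ∈ inArcs {i}, x a = 1)}

/-- The net flow of `f` out of node `i`. -/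
def netOut {n : ℕ} (f : Arc n → ℝ) (i : Fin n) : ℝ :=
  ∑ a ∈ outArcs {i}, f a - ∑ a ∈ inArcs {i}, f a

/-- `f` is a nonnegative flow with capacities `x` that sends one unit out of the special node and
delivers `b i` units to every other node `i`. -/
def IsFlow {n : ℕ} [NeZero n] (x f : Arc n → ℝ) (b : Node1 n → ℝ) : Prop :=
  (∀ a, 0 ≤ f a) ∧ netOut f 0 = 1 ∧ (∀ i : Node1 n, netOut f i = -b i) ∧ ∀ a, f a ≤ x a

/-- The extended formulation `Q_SCF(b)`. -/
def QSCF {n : ℕ} [NeZero n] (b : Node1 n → ℝ) : Set ((Arc n → ℝ) × (Arc n → ℝ)) :=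
  {p | p.1 ∈ PAP n ∧ IsFlow p.1 p.2 b}

/-- The projection `P_SCF(b)` of `Q_SCF(b)` onto the `x`-variables. -/
def PSCF {n : ℕ} [NeZero n] (b : Node1 n → ℝ) : Set (Arc n → ℝ) :=
  Prod.fst '' QSCF b

/-- The parameter set `B`: positive vectors with entries summing to one. -/
def paramB (n : ℕ) [NeZero n] : Set (Node1 n → ℝ) :=
  {b | (∀ i, 0 < b i) ∧ ∑ i, b i = 1}

/-- The `k`-th canonical vector. -/
def canonicalVec {n : ℕ} [NeZero n] (k : Node1 n) : Node1 n → ℝ :=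
  fun i => if i = k then 1 else 0

/-- The set `V_SCF` of the `n - 1` canonical vectors. -/
def canonicalVecs (n : ℕ) [NeZero n] : Set (Node1 n → ℝ) :=
  Set.range canonicalVec

/-- The closure of the family `P_SCF(b)`, `b ∈ B'`. -/
def closureSCF {n : ℕ} [NeZero n] (B' : Set (Node1 n → ℝ)) : Set (Arc n → ℝ) :=
  ⋂ b ∈ B', PSCF b

/-- The Dantzig-Fulkerson-Johnson polytope, given by the cut inequalities. -/
def PDFJ (n : ℕ) [NeZero n] : Set (Arc n → ℝ) :=
  {x | x ∈ PAP n ∧ ∀ S ∈ subtourSets n, 1 ≤ ∑ a ∈ outArcs S, x a}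

/-- The Dantzig-Fulkerson-Johnson polytope, given by the clique inequalities. -/
def PClique (n : ℕ) [NeZero n] : Set (Arc n → ℝ) :=
  {x | x ∈ PAP n ∧ ∀ S ∈ subtourSets n, ∑ a ∈ insideArcs S, x a ≤ (S.card : ℝ) - 1}

/-- The multi-commodity flow extended formulation: one commodity for each node `k` other than the
special node, whose single unit is sent from the special node to `k`. -/
def QMCF (n : ℕ) [NeZero n] : Set ((Arc n → ℝ) × (Node1 n → Arc n → ℝ)) :=
  {p | p.1 ∈ PAP n ∧ ∀ k : Node1 n,
    (∀ a, 0 ≤ p.2 k a) ∧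
    (∀ i : Fin n, netOut (p.2 k) i = if i = 0 then 1 else if i = k then -1 else 0) ∧
    ∀ a, p.2 k a ≤ p.1 a}

end ATSP

/-!
The equalities rest on two facts about flows with node supplies `d` and arc capacities `x`.

Summing the net outflow over a node set `S` cancels the arcs inside `S` (`sum_netOut`). Applied to
a flow showing `x ∈ P_SCF(b)`, this bounds the demand `b(S)` by the capacity of the cut around `S`
(`demand_le_cut`). Over all unit vectors `b` this is the cut inequality for every `S`; positive `b`
come arbitrarily close to a unit vector, so the cut inequality also follows over all of `B`.

Conversely, a flow exists as soon as every node set has supply at most the capacity leaving it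
(Gale's theorem, `exists_flow_of_cut`). To prove it, minimize the sum of the squared errors
`e i = netOut f i - d i` over the compact box `0 ≤ f ≤ x`. At the minimum, no single arc can be
improved, so an arc from a node of smaller error to one of larger error is saturated, and an arc in
the opposite direction is empty. If the errors, whose sum is zero, do not all vanish, then the set
of nodes where `e` is least violates the cut condition. For `x` in the cut polytope, the cut
condition holds for the supplies of every `b` in the standard simplex (`mem_PSCF_of_mem_PDFJ`).

The clique form follows by counting the arcs that start in `S`, and the multi-commodity formulation
is a choice of one flow for each canonical vector.
-/

namespace ATSP

open Finset

variable {n : ℕ}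

/-! ### Flows and cuts -/

lemma sum_sum_outArcs (f : Arc n → ℝ) (S : Finset (Fin n)) :
    ∑ i ∈ S, ∑ a ∈ outArcs {i}, f a = ∑ a ∈ outArcs S, f a + ∑ a ∈ insideArcs S, f a := by
  have h1 : ∀ i, ∑ a ∈ outArcs {i}, f a = ∑ a : Arc n, if a.1.1 = i then f a else 0 := by
    intro i
    rw [outArcs, sum_filter]
    refine sum_congr rfl fun a _ => ?_
    have := a.2
    grind
  simp_rw [h1]
  rw [sum_comm, outArcs, insideArcs, sum_filter, sum_filter, ← sum_add_distrib]
  refine sum_congr rfl fun a _ => ?_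
  rw [sum_ite_eq]
  grind

lemma sum_sum_inArcs (f : Arc n → ℝ) (S : Finset (Fin n)) :
    ∑ i ∈ S, ∑ a ∈ inArcs {i}, f a = ∑ a ∈ inArcs S, f a + ∑ a ∈ insideArcs S, f a := by
  have h1 : ∀ i, ∑ a ∈ inArcs {i}, f a = ∑ a : Arc n, if a.1.2 = i then f a else 0 := by
    intro i
    rw [inArcs, sum_filter]
    refine sum_congr rfl fun a _ => ?_
    have := a.2
    grind
  simp_rw [h1]
  rw [sum_comm, inArcs, insideArcs, sum_filter, sum_filter, ← sum_add_distrib]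
  refine sum_congr rfl fun a _ => ?_
  rw [sum_ite_eq]
  grind

lemma sum_netOut (f : Arc n → ℝ) (S : Finset (Fin n)) :
    ∑ i ∈ S, netOut f i = ∑ a ∈ outArcs S, f a - ∑ a ∈ inArcs S, f a := by
  simp only [netOut, sum_sub_distrib, sum_sum_outArcs, sum_sum_inArcs]
  ring

lemma outArcs_compl (S : Finset (Fin n)) : outArcs Sᶜ = inArcs S := by
  ext a; simp [outArcs, inArcs]

lemma netOut_add_smul_single (f : Arc n → ℝ) (a : Arc n) (t : ℝ) (i : Fin n) :
    netOut (f + t • Pi.single a 1) i =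
      netOut f i + t * ((if a.1.1 = i then 1 else 0) - if a.1.2 = i then 1 else 0) := by
  have ha := a.2
  have h (s : Finset (Arc n)) :
      ∑ b ∈ s, (Pi.single a (1 : ℝ) : Arc n → ℝ) b = if a ∈ s then 1 else 0 := by
    simp [Pi.single_apply, sum_ite_eq']
  simp only [netOut, Pi.add_apply, Pi.smul_apply, smul_eq_mul, sum_add_distrib, ← mul_sum, h,
    outArcs, inArcs, mem_filter, mem_univ, true_and, mem_singleton]
  have h1 : (a.1.1 = i ∧ ¬a.1.2 = i) ↔ a.1.1 = i := by grind
  have h2 : (¬a.1.1 = i ∧ a.1.2 = i) ↔ a.1.2 = i := by grind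
  simp only [h1, h2]
  ring

/-- Effect of adding `t` to the flow on one arc on the sum of squared errors: if the errors
at the two ends differ, then for small `t` its sign is that of `t` times their difference. -/
lemma sum_sq_error_add_smul_single (f : Arc n → ℝ) (d : Fin n → ℝ) (a : Arc n) (t : ℝ) :
    ∑ i, (netOut (f + t • Pi.single a 1) i - d i) ^ 2 =
      ∑ i, (netOut f i - d i) ^ 2 +
        2 * t * ((netOut f a.1.1 - d a.1.1) - (netOut f a.1.2 - d a.1.2) + t) := by
  have ha := a.2
  have h : ∀ i, (netOut (f + t • Pi.single a 1) i - d i) ^ 2 =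
      (netOut f i - d i) ^ 2 +
        ((if a.1.1 = i then 2 * t * (netOut f i - d i) + t ^ 2 else 0) +
          if a.1.2 = i then -(2 * t * (netOut f i - d i)) + t ^ 2 else 0) := by
    intro i
    rw [netOut_add_smul_single]
    split_ifs <;> grind
  simp_rw [h]
  rw [sum_add_distrib, sum_add_distrib, sum_ite_eq, sum_ite_eq]
  simp only [mem_univ, if_true]
  ring

/-- Gale's feasibility theorem: if the supplies `d` sum to zero and the supply of every node set is
at most the capacity of the arcs leaving it, then some flow within the capacities meets `d`. -/
theorem exists_flow_of_cut (x : Arc n → ℝ) (d : Fin n → ℝ) (hx : 0 ≤ x) (hd : ∑ i, d i = 0)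
    (hcut : ∀ S : Finset (Fin n), ∑ i ∈ S, d i ≤ ∑ a ∈ outArcs S, x a) :
    ∃ f : Arc n → ℝ, 0 ≤ f ∧ f ≤ x ∧ ∀ i, netOut f i = d i := by
  obtain ⟨f, ⟨hf0, hfx⟩, hmin⟩ := (isCompact_Icc (a := 0) (b := x)).exists_isMinOn
    ⟨0, le_rfl, hx⟩
    (f := fun f : Arc n → ℝ => ∑ i, (netOut f i - d i) ^ 2)
    (by unfold netOut; fun_prop)
  refine ⟨f, hf0, hfx, ?_⟩
  set e : Fin n → ℝ := fun i => netOut f i - d i with he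
  have key (a : Arc n) (t : ℝ) (h0 : 0 ≤ f a + t) (h1 : f a + t ≤ x a) :
      0 ≤ 2 * t * (e a.1.1 - e a.1.2 + t) := by
    have hmem : f + t • Pi.single a 1 ∈ Set.Icc 0 x := by
      constructor <;> intro b <;> have := hf0 b <;> have := hfx b <;>
        by_cases hb : b = a <;> simp_all
    have := hmin hmem
    simp only [Set.mem_ofPred_eq, sum_sq_error_add_smul_single] at this
    linarith
  -- A step of at most half the difference of the errors keeps the factor `e a.1.1 - e a.1.2 + t`
  -- of the same sign as `e a.1.1 - e a.1.2`.
  have hsat (a : Arc n) (h : e a.1.1 < e a.1.2) : f a = x a := by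
    by_contra hne
    have hlt : f a < x a := lt_of_le_of_ne (hfx a) hne
    have hf0a : 0 ≤ f a := hf0 a
    set t := min (x a - f a) ((e a.1.2 - e a.1.1) / 2)
    have ht : 0 < t := lt_min (by linarith) (by linarith)
    have h1 : t ≤ x a - f a := min_le_left _ _
    have h2 : t ≤ (e a.1.2 - e a.1.1) / 2 := min_le_right _ _
    have := key a t (by linarith) (by linarith)
    have := mul_neg_of_pos_of_neg (a := 2 * t) (b := e a.1.1 - e a.1.2 + t)
      (by linarith) (by linarith)
    linarith
  have hzero (a : Arc n) (h : e a.1.2 < e a.1.1) : f a = 0 := by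
    by_contra hne
    have hlt : 0 < f a := lt_of_le_of_ne (hf0 a) (Ne.symm hne)
    have hfxa : f a ≤ x a := hfx a
    set t := min (f a) ((e a.1.1 - e a.1.2) / 2)
    have ht : 0 < t := lt_min hlt (by linarith)
    have h1 : t ≤ f a := min_le_left _ _
    have h2 : t ≤ (e a.1.1 - e a.1.2) / 2 := min_le_right _ _
    have := key a (-t) (by linarith) (by linarith)
    have := mul_pos (a := 2 * t) (b := e a.1.1 - e a.1.2 - t) (by linarith) (by linarith)
    linarith
  have hesum : ∑ i, e i = 0 := by
    have : outArcs (univ : Finset (Fin n)) = ∅ := by ext a; simp [outArcs]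
    have h2 : inArcs (univ : Finset (Fin n)) = ∅ := by ext a; simp [inArcs]
    simp [he, sum_sub_distrib, hd, sum_netOut, this, h2]
  suffices h : ∀ i, 0 ≤ e i by
    intro i
    have := (sum_eq_zero_iff_of_nonneg fun i _ => h i).1 hesum i (mem_univ i)
    exact sub_eq_zero.1 this
  by_contra! hneg
  obtain ⟨j, hj⟩ := hneg
  obtain ⟨m, -, hm⟩ := exists_min_image univ e ⟨j, mem_univ j⟩
  have hem : e m < 0 := (hm j (mem_univ j)).trans_lt hj
  set S : Finset (Fin n) := univ.filter fun i => e i = e m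
  have hS : ∀ i, i ∈ S ↔ e i = e m := by simp [S]
  have hlt : ∀ i, i ∉ S → e m < e i := fun i hi =>
    lt_of_le_of_ne (hm i (mem_univ i)) fun h => hi ((hS i).2 h.symm)
  have hout : ∑ a ∈ outArcs S, f a = ∑ a ∈ outArcs S, x a := by
    refine sum_congr rfl fun a ha => hsat a ?_
    simp only [outArcs, mem_filter, mem_univ, true_and] at ha
    rw [(hS _).1 ha.1]
    exact hlt _ ha.2
  have hin : ∑ a ∈ inArcs S, f a = 0 := by
    refine sum_eq_zero fun a ha => hzero a ?_
    simp only [inArcs, mem_filter, mem_univ, true_and] at ha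
    rw [(hS _).1 ha.2]
    exact hlt _ ha.1
  have heS : ∑ i ∈ S, e i < 0 :=
    sum_neg (fun i hi => by rw [(hS i).1 hi]; exact hem) ⟨m, (hS m).2 rfl⟩
  have hnet := sum_netOut f S
  have := hcut S
  simp only [he, sum_sub_distrib] at heS
  linarith

/-! ### The assignment polytope -/

lemma PAP.out_eq_in {x : Arc n → ℝ} (hx : x ∈ PAP n) (S : Finset (Fin n)) :
    ∑ a ∈ outArcs S, x a = ∑ a ∈ inArcs S, x a := by
  have h := sum_netOut x S
  simp only [netOut, hx.2.1, hx.2.2, sub_self, sum_const_zero] at h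
  linarith

lemma PAP.out_add_inside {x : Arc n → ℝ} (hx : x ∈ PAP n) (S : Finset (Fin n)) :
    ∑ a ∈ outArcs S, x a + ∑ a ∈ insideArcs S, x a = S.card := by
  rw [← sum_sum_outArcs]
  simp [hx.2.1]

theorem PDFJ_eq_PClique [NeZero n] : PDFJ n = PClique n := by
  ext x
  refine and_congr_right fun hx => forall₂_congr fun S _ => ?_
  have := PAP.out_add_inside hx S
  constructor <;> intro h <;> linarith

/-! ### Single-commodity flows -/

variable [NeZero n]

/-- The demand of a set of nodes avoiding the special node is at most the capacity of its cut. -/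
lemma demand_le_cut {x : Arc n → ℝ} {b : Node1 n → ℝ} (hx : x ∈ PSCF b)
    {S : Finset (Fin n)} (hS : 0 ∉ S) :
    ∑ i : Node1 n with i.1 ∈ S, b i ≤ ∑ a ∈ outArcs S, x a := by
  obtain ⟨⟨x', f⟩, ⟨hxP, hf0, -, hfb, hfx⟩, rfl⟩ := hx
  dsimp only at *
  have hsum : ∑ i ∈ S, netOut f i = -∑ i : Node1 n with i.1 ∈ S, b i := by
    rw [← sum_neg_distrib]
    symm
    refine sum_bij (fun i _ => i.1) (by simp) (fun i _ j _ h => Subtype.ext h) ?_ ?_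
    · intro i hi
      exact ⟨⟨i, fun h => hS (h ▸ hi)⟩, by simpa using hi, rfl⟩
    · intro i _
      rw [hfb i]
  have h1 := sum_netOut f S
  have h2 : 0 ≤ ∑ a ∈ outArcs S, f a := sum_nonneg fun a _ => hf0 a
  have h3 : ∑ a ∈ inArcs S, f a ≤ ∑ a ∈ inArcs S, x' a := sum_le_sum fun a _ => hfx a
  rw [PAP.out_eq_in hxP]
  linarith

/-- The cut inequality in the cut polytope, extended from `subtourSets` to all nonempty sets
avoiding the special node. -/
lemma PDFJ.one_le_out {x : Arc n → ℝ} (hx : x ∈ PDFJ n) {S : Finset (Fin n)} (hS : 0 ∉ S)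
    (hne : S.Nonempty) : 1 ≤ ∑ a ∈ outArcs S, x a := by
  by_cases h : 2 ≤ S.card
  · exact hx.2 S ⟨hS, h⟩
  · obtain ⟨i, rfl⟩ := card_eq_one.1 (show S.card = 1 by have := hne.card_pos; omega)
    exact (hx.1.2.1 i).ge

theorem mem_PSCF_of_mem_PDFJ {x : Arc n → ℝ} (hx : x ∈ PDFJ n) {b : Node1 n → ℝ}
    (hb : b ∈ stdSimplex ℝ (Node1 n)) : x ∈ PSCF b := by
  obtain ⟨hb0, hb1⟩ := hb
  set d : Fin n → ℝ := fun i => if h : i = 0 then 1 else -b ⟨i, h⟩ with hd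
  have hd0 : d 0 = 1 := by simp [hd]
  have hdi (i : Node1 n) : d i = -b i := by simp [hd, i.2]
  have hdneg (i : Fin n) (h : i ≠ 0) : d i ≤ 0 := by
    have := hb0 ⟨i, h⟩
    simp only [hd, h, dif_neg, not_false_eq_true]
    linarith
  have hx0 : 0 ≤ x := fun a => (hx.1.1 a).1
  have hsum : ∑ i, d i = 0 := by
    have hs : ∑ i ∈ univ.erase 0, d i = ∑ i : Node1 n, d i := sum_subtype _ (by simp) d
    rw [← add_sum_erase univ d (mem_univ 0), hd0, hs]
    simp only [hdi, sum_neg_distrib, hb1]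
    norm_num
  obtain ⟨f, hf0, hfx, hf⟩ := exists_flow_of_cut x d hx0 hsum fun S => by
    by_cases h0 : 0 ∈ S
    · by_cases hc : Sᶜ.Nonempty
      · have h1 := PDFJ.one_le_out hx (S := Sᶜ) (by simpa using h0) hc
        rw [outArcs_compl, ← PAP.out_eq_in hx.1] at h1
        have h2 : ∑ i ∈ S.erase 0, d i ≤ 0 :=
          sum_nonpos fun i hi => hdneg i (ne_of_mem_erase hi)
        have h3 := add_sum_erase S d h0
        linarith
      · obtain rfl : S = univ := by
          rwa [not_nonempty_iff_eq_empty, compl_eq_empty_iff] at hc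
        rw [hsum]
        exact sum_nonneg fun a _ => hx0 a
    · exact (sum_nonpos fun i hi => hdneg i fun h => h0 (h ▸ hi)).trans
        (sum_nonneg fun a _ => hx0 a)
  exact ⟨(x, f), ⟨hx.1, hf0, (hf 0).trans hd0, fun i => (hf i).trans (hdi i), hfx⟩, rfl⟩

/-! ### The closures and the multi-commodity formulation -/

lemma canonicalVec_mem_stdSimplex (k : Node1 n) : canonicalVec k ∈ stdSimplex ℝ (Node1 n) := by
  refine ⟨fun i => ?_, by simp [canonicalVec]⟩
  unfold canonicalVec
  split_ifs <;> norm_num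

lemma sum_canonicalVec_of_mem {S : Finset (Fin n)} {k : Node1 n} (hk : k.1 ∈ S) :
    ∑ i : Node1 n with i.1 ∈ S, canonicalVec k i = 1 := by
  simp [canonicalVec, hk]

lemma exists_node1_mem {S : Finset (Fin n)} (hS : S ∈ subtourSets n) :
    ∃ k : Node1 n, k.1 ∈ S := by
  obtain ⟨k, hk⟩ := card_pos.1 (show 0 < S.card by have := hS.2; omega)
  exact ⟨⟨k, fun h => hS.1 (h ▸ hk)⟩, hk⟩

theorem closureSCF_canonicalVecs_eq_PDFJ [Nonempty (Node1 n)] :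
    closureSCF (canonicalVecs n) = PDFJ n := by
  ext x
  simp only [closureSCF, canonicalVecs, Set.mem_iInter, Set.forall_mem_range]
  refine ⟨fun h => ⟨?_, fun S hS => ?_⟩, fun hx k =>
    mem_PSCF_of_mem_PDFJ hx (canonicalVec_mem_stdSimplex k)⟩
  · obtain ⟨p, hp, rfl⟩ := h (Classical.arbitrary _)
    exact hp.1
  · obtain ⟨k, hk⟩ := exists_node1_mem hS
    have := demand_le_cut (h k) hS.1
    rwa [sum_canonicalVec_of_mem hk] at this

theorem closureSCF_paramB_eq_PDFJ [Nonempty (Node1 n)] :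
    closureSCF (paramB n) = PDFJ n := by
  ext x
  simp only [closureSCF, Set.mem_iInter]
  refine ⟨fun h => ?_, fun hx b hb =>
    mem_PSCF_of_mem_PDFJ hx ⟨fun i => (hb.1 i).le, hb.2⟩⟩
  -- Perturbing a canonical vector towards the barycentre of the simplex makes it positive.
  set u : ℝ := (Fintype.card (Node1 n) : ℝ)⁻¹
  have hu : 0 < u := by positivity
  have hb (k : Node1 n) (ε : ℝ) (h0 : 0 < ε) (h1 : ε ≤ 1) :
      (fun i => (1 - ε) * canonicalVec k i + ε * u) ∈ paramB n := by
    refine ⟨fun i => ?_, ?_⟩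
    · have := (canonicalVec_mem_stdSimplex k).1 i
      have := mul_nonneg (sub_nonneg.2 h1) this
      have := mul_pos h0 hu
      linarith
    · rw [sum_add_distrib, ← mul_sum, (canonicalVec_mem_stdSimplex k).2]
      rw [sum_const, card_univ, nsmul_eq_mul, mul_left_comm, mul_inv_cancel₀ (by positivity)]
      ring
  refine ⟨?_, fun S hS => ?_⟩
  · obtain ⟨p, hp, rfl⟩ := h _ (hb (Classical.arbitrary _) 1 one_pos le_rfl)
    exact hp.1
  · obtain ⟨k, hk⟩ := exists_node1_mem hS
    by_contra! hlt
    have hnn : 0 ≤ ∑ a ∈ outArcs S, x a := by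
      obtain ⟨p, hp, rfl⟩ := h _ (hb k 1 one_pos le_rfl)
      exact sum_nonneg fun a _ => (hp.1.1 a).1
    set ε := 1 - ∑ a ∈ outArcs S, x a with hε
    have h0 : 0 < ε := by linarith
    have := demand_le_cut (h _ (hb k (ε / 2) (by linarith) (by linarith))) hS.1
    rw [sum_add_distrib, ← mul_sum, sum_canonicalVec_of_mem hk] at this
    have h2 : 0 ≤ ∑ i : Node1 n with i.1 ∈ S, ε / 2 * u :=
      sum_nonneg fun i _ => by positivity
    linarith

lemma mem_QMCF_iff {x : Arc n → ℝ} {f : Node1 n → Arc n → ℝ} :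
    (x, f) ∈ QMCF n ↔ x ∈ PAP n ∧ ∀ k, IsFlow x (f k) (canonicalVec k) := by
  refine and_congr_right fun _ => forall_congr' fun k => and_congr_right fun _ => ?_
  rw [← and_assoc]
  refine and_congr_left fun _ => ⟨fun h => ⟨by simpa using h 0, fun i => ?_⟩, fun h i => ?_⟩
  · rw [h i, if_neg i.2, canonicalVec]
    by_cases hik : i = k
    · simp [hik]
    · simp [hik, Subtype.ext_iff.not.1 hik]
  · by_cases hi : i = 0
    · simpa [hi] using h.1
    · rw [h.2 ⟨i, hi⟩, if_neg hi, canonicalVec]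
      by_cases hik : i = k.1
      · simp [hik]
      · simp [hik, Subtype.ext_iff]

theorem image_fst_QMCF_eq_PDFJ [Nonempty (Node1 n)] : Prod.fst '' QMCF n = PDFJ n := by
  rw [← closureSCF_canonicalVecs_eq_PDFJ]
  ext x
  simp only [closureSCF, canonicalVecs, Set.mem_iInter, Set.forall_mem_range]
  constructor
  · rintro ⟨⟨x, f⟩, hp, rfl⟩ k
    obtain ⟨hx, hf⟩ := mem_QMCF_iff.1 hp
    exact ⟨(x, f k), ⟨hx, hf k⟩, rfl⟩
  · intro h
    have h' : ∀ k : Node1 n, ∃ f, x ∈ PAP n ∧ IsFlow x f (canonicalVec k) := by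
      intro k
      obtain ⟨⟨x, f⟩, hp, rfl⟩ := h k
      exact ⟨f, hp⟩
    choose f hx hf using h'
    exact ⟨(x, f), mem_QMCF_iff.2 ⟨hx (Classical.arbitrary _), hf⟩, rfl⟩

end ATSP

theorem mainTheorem3 (n : ℕ) [NeZero n] (hn : 4 ≤ n) :
    ATSP.closureSCF (ATSP.paramB n) = ATSP.closureSCF (ATSP.canonicalVecs n) ∧
    ATSP.closureSCF (ATSP.canonicalVecs n) = ATSP.PDFJ n ∧
    ATSP.PDFJ n = ATSP.PClique n ∧
    Prod.fst '' ATSP.QMCF n = ATSP.PDFJ n := by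
  have : Nonempty (ATSP.Node1 n) :=
    ⟨⟨⟨1, by omega⟩, fun h => by simpa using congrArg Fin.val h⟩⟩
  rw [ATSP.closureSCF_paramB_eq_PDFJ, ATSP.closureSCF_canonicalVecs_eq_PDFJ,
    ATSP.image_fst_QMCF_eq_PDFJ]
  exact ⟨rfl, rfl, ATSP.PDFJ_eq_PClique, rfl⟩
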